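/- Let $r\ge 0$, let $\mathbf F_r$ be the free group on $r$ generators $x_1,\dots,x_r$, and let $w\in\mathbf F_r$. Definitions. The commutator length $\mathrm{cl}(w)$ is the least $g\ge 0$ such that $w=[u_1,v_1]\cdots[u_g,v_g]$ for some $u_i,v_i\in\mathbf F_r$, where $[u,v]=uvu^{-1}v^{-1}$; the square length $\mathrm{sql}(w)$ is the least $g\ge 0$ such that $w=u_1^2\cdots u_g^2$ for some $u_i\in\mathbf F_r$; each is $\infty$ if there is no such $g$. For a free group $H$ let $K_\infty(H)=[H,H]$, and let $K_2(H)$ be the set of elements of $H$ in which every element of a (equivalently, any) fixed basis of $H$ has even total exponent. For $m\in\{2,\infty\}$ put $$\chi_m(w)=1-\min\{\operatorname{rank}(H) : H\le\mathbf F_r,\ w\in K_m(H)\},$$ with $\chi_m(w)=-\infty$ if there is no such $H$. Let $S^1\wr S_N\le \mathrm{GL}_N(\mathbb C)$ be the compact group of matrices with exactly one non-zero entry in every row and every column, all non-zero entries having absolute value $1$, and let $C_2\wr S_N$ be its subgroup of matrices whose non-zero entries are $\pm1$. For a compact matrix group $G$, let $\mathrm{tr}_w(G)$ be the expected trace of $w(g_1,\dots,g_r)$,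 where $g_1,\dots,g_r$ are independent Haar-distributed random elements of $G$ and $w(g_1,\dots,g_r)$ is obtained by substituting $g_i$ for $x_i$ in $w$. Write $f(N)=\Omega(g(N))$ if there is a constant $C>0$ such that $|f(N)|\ge C\,g(N)$ for every large enough $N$ (here $C$ and the threshold may depend on $w$). We use the conventions $1-\infty=-\infty$ and $N^{-\infty}=0$. Statement. We have $$\chi_\infty(w)\ge 1-2\,\mathrm{cl}(w)\qquad\text{and}\qquad \chi_2(w)\ge 1-\min\bigl(\mathrm{sql}(w),\,2\,\mathrm{cl}(w)\bigr),$$ and $$\mathrm{tr}_w(S^1\wr S_N)=\Omega\bigl(N^{1-2\,\mathrm{cl}(w)}\bigr)\qquad\text{and}\qquad \mathrm{tr}_w(C_2\wr S_N)=\Omega\bigl(N^{1-\min(\mathrm{sql}(w),\,2\,\mathrm{cl}(w))}\bigr)\qquad(N\to\infty).$$ -/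

import Mathlib

open MeasureTheory Filter

/-! ### Invariants of words in free groups -/

/-- The free group `F_r` on `r` generators. -/
abbrev FreeGrp (r : ℕ) : Type := FreeGroup (Fin r)

/-- The commutator length of `w`: the least `g` such that `w` is a product of `g` commutators
`u v u⁻¹ v⁻¹`; it is `⊤` if there is no such `g`. -/
noncomputable def commLength {r : ℕ} (w : FreeGrp r) : ℕ∞ :=
  sInf {n : ℕ∞ | ∃ g : ℕ, n = g ∧ ∃ u v : Fin g → FreeGrp r,
    w = (List.ofFn fun i => u i * v i * (u i)⁻¹ * (v i)⁻¹).prod}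

/-- The square length of `w`: the least `g` such that `w` is a product of `g` squares; it is `⊤`
if there is no such `g`. -/
noncomputable def squareLength {r : ℕ} (w : FreeGrp r) : ℕ∞ :=
  sInf {n : ℕ∞ | ∃ g : ℕ, n = g ∧ ∃ u : Fin g → FreeGrp r,
    w = (List.ofFn fun i => u i ^ 2).prod}

/-- The rank of a free group: the cardinality of a basis. -/
noncomputable def freeRank (G : Type*) [Group G] [IsFreeGroup G] : ℕ∞ :=
  ENat.card (IsFreeGroup.Generators G)

/-- For a free group `G` with basis `X` and a natural number `m`, the homomorphism
`G → ⨁_{x ∈ X} ℤ/mℤ` which maps each basis element to the corresponding standard generator. -/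
noncomputable def expHom (m : ℕ) (G : Type*) [Group G] [IsFreeGroup G] :
    G →* Multiplicative (IsFreeGroup.Generators G →₀ ZMod m) :=
  IsFreeGroup.lift fun x => Multiplicative.ofAdd (Finsupp.single x 1)

/-- The subgroup `K_m(G)` of a free group `G`. If `m` is finite this is the kernel of the
homomorphism from `G` to the power of `ℤ/mℤ` indexed by a basis; if `m = ∞` it is the
commutator subgroup. -/
noncomputable def freeK : (m : ℕ∞) → (G : Type*) → [Group G] → [IsFreeGroup G] → Subgroup G
  | ⊤, G, _, _ => commutator G
  | (m : ℕ), G, _, _ => (expHom m G).ker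

/-- `1 - n` in `ℤ ∪ {-∞}`, with `1 - ∞ = -∞`. -/
def oneSub : ℕ∞ → WithBot ℤ
  | ⊤ => ⊥
  | (n : ℕ) => ((1 - (n : ℤ) : ℤ) : WithBot ℤ)

/-- `χ_m(w) = 1 - min {rank H : H ≤ F_r, w ∈ K_m(H)}`, equal to `-∞` if there is no such `H`. -/
noncomputable def chi {r : ℕ} (m : ℕ∞) (w : FreeGrp r) : WithBot ℤ :=
  oneSub (sInf {n : ℕ∞ | ∃ H : Subgroup (FreeGrp r),
    w ∈ (freeK m H).map H.subtype ∧ n = freeRank H})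

/-! ### Word measures on compact groups -/

section WordMeasure

variable (G : Type*) [Group G] [TopologicalSpace G] [IsTopologicalGroup G] [CompactSpace G]
  [MeasurableSpace G] [BorelSpace G]

/-- The Haar probability measure of a compact group. -/
noncomputable def haarProb : Measure G := Measure.haarMeasure ⊤

/-- The `w`-measure on a compact group `G`: the push-forward of the product of Haar probability
measures under the word map `G × ... × G → G`, which substitutes elements of `G` for the
generators. -/
noncomputable def wordMeasure {r : ℕ} (w : FreeGrp r) : Measure G :=
  (Measure.pi fun _ : Fin r => haarProb G).map fun g => FreeGroup.lift g w

end WordMeasure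

/-! ### Generalized symmetric groups -/

/-- The monomial matrix whose only non-zero entry in row `i` is `d i`, in column `σ i`, as an
invertible matrix. -/
noncomputable def monomialMatrix {N : ℕ} (σ : Equiv.Perm (Fin N)) (d : Fin N → Circle) :
    GL (Fin N) ℂ where
  val := Matrix.of fun i j => if σ i = j then (d i : ℂ) else 0
  inv := Matrix.of fun i j => if σ j = i then ((d j)⁻¹ : Circle) else (0 : ℂ)
  val_inv := by
    ext i k
    simp only [Matrix.mul_apply, Matrix.of_apply, ite_mul, zero_mul, Finset.sum_ite_eq,
      Finset.mem_univ, if_true, EmbeddingLike.apply_eq_iff_eq, Matrix.one_apply]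
    by_cases h : i = k
    · subst h; simp
    · simp [h, Ne.symm h]
  inv_val := by
    ext i k
    obtain ⟨i', rfl⟩ := σ.surjective i
    rw [Matrix.mul_apply, Finset.sum_eq_single i']
    · simp [Matrix.one_apply]
    · intro j _ hj
      simp [hj]
    · simp

lemma monomialMatrix_mul {N : ℕ} (σ τ : Equiv.Perm (Fin N)) (d e : Fin N → Circle) :
    monomialMatrix σ d * monomialMatrix τ e = monomialMatrix (τ * σ) (fun i => d i * e (σ i)) := by
  ext i k
  simp only [Units.val_mul, monomialMatrix, Matrix.mul_apply, Matrix.of_apply]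
  rw [Finset.sum_eq_single (σ i)]
  · by_cases h : τ (σ i) = k <;> simp [h]
  · intro j _ hj
    simp [Ne.symm hj]
  · simp

lemma monomialMatrix_one {N : ℕ} :
    (monomialMatrix 1 1 : GL (Fin N) ℂ) = 1 := by
  ext i k
  by_cases h : i = k
  · subst h; simp [monomialMatrix]
  · simp [monomialMatrix, h]

/-- `M` has exactly one non-zero entry in every row and in every column, and all non-zero entries
lie in the subgroup `A` of the unit circle. -/
def IsMonomial {N : ℕ} (A : Subgroup Circle) (M : Matrix (Fin N) (Fin N) ℂ) : Prop :=
  (∀ i, ∃! j, M i j ≠ 0) ∧ (∀ j, ∃! i, M i j ≠ 0) ∧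
    ∀ i j, M i j ≠ 0 → ∃ a ∈ A, (a : ℂ) = M i j

lemma isMonomial_iff {N : ℕ} (A : Subgroup Circle) (M : GL (Fin N) ℂ) :
    IsMonomial A (M : Matrix (Fin N) (Fin N) ℂ) ↔
      ∃ (σ : Equiv.Perm (Fin N)) (d : Fin N → Circle), (∀ i, d i ∈ A) ∧ M = monomialMatrix σ d := by
  constructor
  · rintro ⟨h1, h2, h3⟩
    choose f hf hf' using h1
    have hinj : Function.Injective f := by
      intro i i' h
      exact (h2 (f i)).unique (hf i) (h ▸ hf i')
    choose d hd hd' using fun i => h3 i (f i) (hf i)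
    refine ⟨Equiv.ofBijective f (Finite.injective_iff_bijective.1 hinj), d, hd, ?_⟩
    ext i j
    by_cases h : f i = j
    · subst h; simp [monomialMatrix, hd']
    · have : (M : Matrix (Fin N) (Fin N) ℂ) i j = 0 := by
        by_contra hne
        exact h (hf' i j hne).symm
      simp [monomialMatrix, h, this]
  · rintro ⟨σ, d, hd, rfl⟩
    have key : ∀ i j, (monomialMatrix σ d : Matrix (Fin N) (Fin N) ℂ) i j ≠ 0 ↔ σ i = j := by
      intro i j
      simp [monomialMatrix]
    refine ⟨fun i => ⟨σ i, (key _ _).2 rfl, fun j hj => ((key _ _).1 hj).symm⟩,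
      fun j => ⟨σ.symm j, (key _ _).2 (by simp), fun i hi => by simp [← (key _ _).1 hi]⟩, ?_⟩
    intro i j hij
    exact ⟨d i, hd i, by simp [monomialMatrix, (key _ _).1 hij]⟩

/-- The wreath product `A ≀ S_N` for a subgroup `A` of the unit circle, as the group of all
`N × N` matrices with exactly one non-zero entry in every row and column and with all non-zero
entries in `A`. -/
noncomputable def wreathGL (A : Subgroup Circle) (N : ℕ) : Subgroup (GL (Fin N) ℂ) where
  carrier := {M | IsMonomial A (M : Matrix (Fin N) (Fin N) ℂ)}
  mul_mem' := by
    intro a b ha hb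
    simp only [Set.mem_ofPred_eq, isMonomial_iff] at ha hb ⊢
    obtain ⟨σ, d, hd, rfl⟩ := ha
    obtain ⟨τ, e, he, rfl⟩ := hb
    exact ⟨_, _, fun i => A.mul_mem (hd i) (he _), monomialMatrix_mul σ τ d e⟩
  one_mem' := by
    simp only [Set.mem_ofPred_eq, isMonomial_iff]
    exact ⟨1, 1, fun _ => A.one_mem, monomialMatrix_one.symm⟩
  inv_mem' := by
    intro a ha
    simp only [Set.mem_ofPred_eq, isMonomial_iff] at ha ⊢
    obtain ⟨σ, d, hd, rfl⟩ := ha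
    refine ⟨σ⁻¹, fun i => (d (σ⁻¹ i))⁻¹, fun i => A.inv_mem (hd _), ?_⟩
    rw [inv_eq_iff_mul_eq_one, monomialMatrix_mul, ← monomialMatrix_one]
    congr 1
    · simp
    · ext i; simp

lemma isCompact_wreathGL (A : Subgroup Circle) (hA : IsCompact (A : Set Circle)) (N : ℕ) :
    IsCompact (wreathGL A N : Set (GL (Fin N) ℂ)) := by
  have h : (wreathGL A N : Set (GL (Fin N) ℂ)) =
      ⋃ σ : Equiv.Perm (Fin N), monomialMatrix σ '' (Set.univ.pi fun _ => (A : Set Circle)) := by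
    ext M
    change IsMonomial A (M : Matrix (Fin N) (Fin N) ℂ) ↔ _
    rw [isMonomial_iff]
    simp only [Set.mem_iUnion, Set.mem_image, Set.mem_univ_pi, SetLike.mem_coe]
    constructor
    · rintro ⟨σ, d, hd, rfl⟩; exact ⟨σ, d, hd, rfl⟩
    · rintro ⟨σ, d, hd, rfl⟩; exact ⟨σ, d, hd, rfl⟩
  rw [h]
  refine isCompact_iUnion fun σ => (isCompact_univ_pi fun _ => hA).image ?_
  rw [Units.continuous_iff]
  constructor
  · refine continuous_matrix fun i j => ?_
    by_cases hij : σ i = j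
    · simp only [Function.comp_apply, monomialMatrix, Matrix.of_apply, hij, if_true]
      fun_prop
    · simp only [Function.comp_apply, monomialMatrix, Matrix.of_apply, hij, if_false]
      fun_prop
  · refine continuous_matrix fun i j => ?_
    by_cases hij : σ j = i
    · simp only [monomialMatrix, Units.inv_mk, Matrix.of_apply, hij, if_true]
      fun_prop
    · simp only [monomialMatrix, Units.inv_mk, Matrix.of_apply, hij, if_false]
      fun_prop

/-- The group `S¹ ≀ S_N`: non-zero entries are arbitrary complex numbers of absolute value one. -/
noncomputable abbrev circleWreath (N : ℕ) : Subgroup (GL (Fin N) ℂ) := wreathGL ⊤ N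

/-- The group `C_m ≀ S_N`, for `m ≥ 1`: non-zero entries are `m`-th roots of unity. -/
noncomputable abbrev cyclicWreath (m N : ℕ) : Subgroup (GL (Fin N) ℂ) :=
  wreathGL (powMonoidHom m : Circle →* Circle).ker N

noncomputable instance (A : Subgroup Circle) (N : ℕ) : MeasurableSpace (wreathGL A N) := borel _

instance (A : Subgroup Circle) (N : ℕ) : BorelSpace (wreathGL A N) := ⟨rfl⟩

instance (N : ℕ) : CompactSpace (circleWreath N) :=
  isCompact_iff_compactSpace.1 (isCompact_wreathGL _ isCompact_univ N)

instance (m N : ℕ) : CompactSpace (cyclicWreath m N) := by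
  refine isCompact_iff_compactSpace.1 (isCompact_wreathGL _ (IsClosed.isCompact ?_) N)
  have : ((powMonoidHom m : Circle →* Circle).ker : Set Circle) = {z | z ^ m = 1} := by
    ext z; simp [MonoidHom.mem_ker]
  rw [this]
  exact isClosed_eq (by fun_prop) continuous_const

/-- The expected trace `tr_w(G)` of a `w`-random element of a compact matrix group `G`. -/
noncomputable def expTrace {N r : ℕ} (G : Subgroup (GL (Fin N) ℂ)) [CompactSpace G]
    [MeasurableSpace G] [BorelSpace G] (w : FreeGrp r) : ℂ :=
  ∫ x, Matrix.trace ((x : GL (Fin N) ℂ) : Matrix (Fin N) (Fin N) ℂ) ∂(wordMeasure G w)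

/-! ### Asymptotics -/

/-- `N ^ e` for an exponent `e ∈ ℤ ∪ {-∞}`, with `N ^ (-∞) = 0`. -/
noncomputable def powExt (N : ℕ) : WithBot ℤ → ℝ
  | ⊥ => 0
  | (e : ℤ) => (N : ℝ) ^ e

/-- `f = Ω(g)`: there is `C > 0` such that `|f n| ≥ C * g n` for every large enough `n`. -/
def IsBigOmega (f : ℕ → ℂ) (g : ℕ → ℝ) : Prop :=
  ∃ C : ℝ, 0 < C ∧ ∀ᶠ n in atTop, C * g n ≤ ‖f n‖

/-! If a length is infinite, the corresponding bounds are trivial. Otherwise write `w` as a product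
of `c` commutators in `2c` words, or of `g` squares of `g` words; call the list of words `us` and
let `H` be the subgroup it generates. Every homomorphism from `H` to a commutative group (of
exponent two, in the case of squares) kills `w`, so `w` lies in `K_m(H)`. Since the rank of `H` is
at most the length of `us`, the bounds on `chi` follow.

For the trace, condition on the permutations `σ` underlying the random matrices. By invariance of
Haar measure, each diagonal entry of `w` on the fibre over `σ` is either identically one or has
integral zero (`fiber_integral_dichotomy`). Contributions are therefore nonnegative and none can
cancel. If all of `us` fix a point `i`, the coefficient at `i` is a homomorphism `H → A`, so it is
one at `w` (`lift_apply_self_eq_one`). Hence the trace is at least the expected number of common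
fixed points of `us` under random permutations.

That number is bounded below by `exists_fixCount_ge`. Fold a rose with petals `us` to a graph with
`v` vertices, `e` edges and `v - e ≥ 1 - length us`. It has about `N ^ v` injective placements of
its vertices, each compatible with `σ` with probability at least `N ^ (-e)`, and each compatible
placement gives a common fixed point. -/

/-! ### Labelled graphs and permutation actions -/

section LabelledGraph

variable {r : ℕ} {V W α : Type}

/-- A map `f` from the vertices of a graph with edges labelled by generators sends each edge
`(s, x, t)` to an edge of the Schreier graph of the permutations `σ`. -/
def IsGraphHom (E : Finset (V × Fin r × V)) (σ : Fin r → Equiv.Perm α) (f : V → α) : Prop :=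
  ∀ s x t, (s, x, t) ∈ E → σ x (f s) = f t

/-- A homomorphism to a Schreier graph is determined by the image of `b`. -/
def IsRigidAt (E : Finset (V × Fin r × V)) (b : V) : Prop :=
  ∀ (α : Type) (σ : Fin r → Equiv.Perm α) (f f' : V → α),
    IsGraphHom E σ f → IsGraphHom E σ f' → f b = f' b → f = f'

/-- No two edges with the same label have the same source or the same target. -/
def IsFoldedGraph (E : Finset (V × Fin r × V)) : Prop :=
  (∀ s x t t', (s, x, t) ∈ E → (s, x, t') ∈ E → t = t') ∧
    ∀ s s' x t, (s, x, t) ∈ E → (s', x, t) ∈ E → s = s'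

/-- The image of a set of edges under a map of vertices. -/
def pushEdges [DecidableEq W] (p : V → W) (E : Finset (V × Fin r × V)) :
    Finset (W × Fin r × W) :=
  E.image fun e => (p e.1, e.2.1, p e.2.2)

lemma mem_pushEdges [DecidableEq W] {p : V → W} {E : Finset (V × Fin r × V)} {s : V} {x : Fin r}
    {t : V} (h : (s, x, t) ∈ E) : (p s, x, p t) ∈ pushEdges p E :=
  Finset.mem_image.2 ⟨_, h, rfl⟩

lemma IsGraphHom.comp [DecidableEq W] {p : V → W} {E : Finset (V × Fin r × V)}
    {F : Finset (W × Fin r × W)} (hF : pushEdges p E ⊆ F) {σ : Fin r → Equiv.Perm α} {f : W → α}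
    (h : IsGraphHom F σ f) : IsGraphHom E σ (f ∘ p) :=
  fun _ _ _ hE => h _ _ _ (hF (mem_pushEdges hE))

lemma IsRigidAt.push [DecidableEq W] {p : V → W} (hp : p.Surjective)
    {E : Finset (V × Fin r × V)} {b : V} (h : IsRigidAt E b) :
    IsRigidAt (pushEdges p E) (p b) := by
  intro α σ f f' hf hf' hb
  exact hp.injective_comp_right (h α σ _ _ (hf.comp subset_rfl) (hf'.comp subset_rfl) hb)

lemma card_pushEdges_le [DecidableEq W] (p : V → W) (E : Finset (V × Fin r × V)) :
    (pushEdges p E).card ≤ E.card :=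
  Finset.card_image_le

/-- Identification of two vertices. -/
lemma exists_identify [Fintype V] [DecidableEq V] (s t : V) (hst : s ≠ t) :
    ∃ (W : Type) (_ : Fintype W) (_ : DecidableEq W) (p : V → W),
      p.Surjective ∧ p s = p t ∧ Fintype.card V = Fintype.card W + 1 := by
  refine ⟨{v // v ≠ t}, inferInstance, inferInstance,
    fun v => if h : v = t then ⟨s, hst⟩ else ⟨v, h⟩, ?_, ?_, ?_⟩
  · rintro ⟨v, hv⟩
    exact ⟨v, by simp [hv]⟩
  · simp [hst]
  · have := Fintype.card_pos_iff.2 ⟨s⟩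
    simp only [ne_eq, Fintype.card_subtype_compl, Fintype.card_unique]
    omega

/-- Folding: every finite labelled graph maps onto a folded one whose Euler characteristic is
at least as large. -/
lemma exists_folded : ∀ (n : ℕ) (V : Type) [Fintype V] [DecidableEq V]
    (E : Finset (V × Fin r × V)), Fintype.card V = n →
    ∃ (W : Type) (_ : Fintype W) (_ : DecidableEq W) (p : V → W), p.Surjective ∧
      IsFoldedGraph (pushEdges p E) ∧
      (pushEdges p E).card + Fintype.card V ≤ E.card + Fintype.card W := by
  intro n
  induction n with
  | zero =>
    intro V _ _ E hV
    have := Fintype.card_eq_zero_iff.1 hV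
    exact ⟨V, inferInstance, inferInstance, id, Function.surjective_id,
      ⟨fun s => isEmptyElim s, fun s => isEmptyElim s⟩,
      by have := card_pushEdges_le id E; omega⟩
  | succ n ih =>
    intro V _ _ E hV
    by_cases hE : IsFoldedGraph E
    · refine ⟨V, inferInstance, inferInstance, id, Function.surjective_id, ?_, ?_⟩
      · simpa [pushEdges] using hE
      · simp [pushEdges]
    -- A failure of foldedness gives distinct edges that coincide once two of their endpoints are
    -- identified, so a fold costs one vertex and at least one edge.
    · obtain ⟨v, v', hv, e, he, e', he', hee, hpush⟩ : ∃ v v' : V, v ≠ v' ∧ ∃ e ∈ E, ∃ e' ∈ E,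
          e ≠ e' ∧ ∀ (W : Type) (p : V → W), p v = p v' →
            (p e.1, e.2.1, p e.2.2) = (p e'.1, e'.2.1, p e'.2.2) := by
        rw [IsFoldedGraph, not_and_or] at hE
        push Not at hE
        rcases hE with ⟨s, x, t, t', h, h', hne⟩ | ⟨s, s', x, t, h, h', hne⟩
        · exact ⟨t, t', hne, _, h, _, h', by simp [hne], fun W p hp => by simp [hp]⟩
        · exact ⟨s, s', hne, _, h, _, h', by simp [hne], fun W p hp => by simp [hp]⟩
      obtain ⟨W, _, _, p, hp, hpv, hcard⟩ := exists_identify v v' hv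
      obtain ⟨X, _, _, q, hq, hfold, hle⟩ := ih W (pushEdges p E) (by omega)
      have hcomp : pushEdges (q ∘ p) E = pushEdges q (pushEdges p E) := by
        simp [pushEdges, Finset.image_image, Function.comp_def]
      have hlt : (pushEdges p E).card < E.card := by
        refine lt_of_le_of_ne (card_pushEdges_le p E) fun h => hee ?_
        exact Finset.card_image_iff.1 h he he' (hpush W p hpv)
      refine ⟨X, inferInstance, inferInstance, q ∘ p, hq.comp hp, hcomp ▸ hfold, ?_⟩
      rw [hcomp]
      omega

/-- Attaching a path reading a given word between two vertices lowers the Euler characteristic by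
at most one. -/
lemma exists_attach_path (l : List (Fin r × Bool)) : ∀ (V : Type) [Fintype V] [DecidableEq V]
    (E : Finset (V × Fin r × V)) (b s t : V), IsRigidAt E b →
    ∃ (W : Type) (_ : Fintype W) (_ : DecidableEq W) (p : V → W) (F : Finset (W × Fin r × W)),
      pushEdges p E ⊆ F ∧ IsRigidAt F (p b) ∧
      F.card + Fintype.card V ≤ E.card + Fintype.card W + 1 ∧
      ∀ (α : Type) (σ : Fin r → Equiv.Perm α) (f : W → α), IsGraphHom F σ f →
        FreeGroup.lift σ (FreeGroup.mk l) (f (p t)) = f (p s) := by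
  induction l with
  | nil =>
    intro V _ _ E b s t hb
    -- The empty word forces the two ends to be glued. This is the only place where the Euler
    -- characteristic may drop, and it drops by at most one.
    by_cases hst : s = t
    · subst hst
      exact ⟨V, inferInstance, inferInstance, id, E, by simp [pushEdges], hb, by omega,
        fun α σ f hf => by simp [← FreeGroup.one_eq_mk]⟩
    · obtain ⟨W, _, _, p, hp, hpst, hcard⟩ := exists_identify s t hst
      refine ⟨W, inferInstance, inferInstance, p, pushEdges p E, subset_rfl, hb.push hp, ?_,
        fun α σ f hf => by simp [← FreeGroup.one_eq_mk, hpst]⟩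
      have := card_pushEdges_le p E
      omega
  | cons a l ih =>
    intro V _ _ E b s t hb
    obtain ⟨x, ε⟩ := a
    -- Words act from right to left, so the first letter is the last edge of the path. It runs from
    -- the new vertex `none` to `s`, and the rest of the word must lead from `t` to `none`. One
    -- vertex and at most one edge are added.
    set e : Option V × Fin r × Option V := if ε then (none, x, some s) else (some s, x, none)
      with he
    have hstep : ∀ (α : Type) (σ : Fin r → Equiv.Perm α) (f : Option V → α),
        IsGraphHom (insert e (pushEdges some E)) σ f →
        (if ε then σ x else (σ x)⁻¹) (f none) = f (some s) := by
      intro α σ f hf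
      cases ε
      · have := hf (some s) x none (by simp [he])
        simp [← this]
      · simpa using hf none x (some s) (by simp [he])
    obtain ⟨W, _, _, p, F, hEF, hrig, hcard, hF⟩ :=
      ih (Option V) (insert e (pushEdges some E)) (some b) none (some t) (by
        intro α σ f f' hf hf' hbb
        have hs : pushEdges some E ⊆ insert e (pushEdges some E) := Finset.subset_insert _ _
        have h0 := hb α σ _ _ (hf.comp hs) (hf'.comp hs) hbb
        funext v
        cases v with
        | some v => exact congrFun h0 v
        | none =>
          -- The new edge determines the image of the new vertex from that of `s`, which keeps the
          -- graph rigid.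
          apply (if ε then σ x else (σ x)⁻¹).injective
          rw [hstep α σ f hf, hstep α σ f' hf']
          exact congrFun h0 s)
    refine ⟨W, inferInstance, inferInstance, p ∘ some, F, ?_, hrig, ?_, ?_⟩
    · refine subset_trans ?_ hEF
      intro y hy
      simp only [pushEdges, Finset.mem_image, Function.comp_apply] at hy
      obtain ⟨a, ha, rfl⟩ := hy
      exact mem_pushEdges (Finset.mem_insert_of_mem (mem_pushEdges ha))
    · have h1 := Finset.card_insert_le e (pushEdges some E)
      have h2 := card_pushEdges_le some E
      rw [Fintype.card_option] at hcard
      omega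
    · intro α σ f hf
      have h1 := hF α σ f hf
      have h2 := hstep α σ _ (hf.comp hEF)
      have h3 : FreeGroup.lift σ (FreeGroup.mk ((x, ε) :: l)) =
          (if ε then σ x else (σ x)⁻¹) * FreeGroup.lift σ (FreeGroup.mk l) := by
        simp only [FreeGroup.lift_mk, List.map_cons, List.prod_cons]
        cases ε <;> rfl
      rw [h3, Equiv.Perm.mul_apply]
      simp only [Function.comp_apply] at h2 ⊢
      rw [h1, h2]

/-- A rose whose petals read the given words, as a rigid graph of small negative Euler
characteristic. -/
lemma exists_rose (us : List (FreeGrp r)) :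
    ∃ (V : Type) (_ : Fintype V) (_ : DecidableEq V) (E : Finset (V × Fin r × V)) (b : V),
      IsRigidAt E b ∧ E.card + 1 ≤ Fintype.card V + us.length ∧
      ∀ (α : Type) (σ : Fin r → Equiv.Perm α) (f : V → α), IsGraphHom E σ f →
        ∀ u ∈ us, FreeGroup.lift σ u (f b) = f b := by
  induction us with
  | nil =>
    exact ⟨Unit, inferInstance, inferInstance, ∅, (), fun α σ f f' _ _ h => funext fun _ => h,
      by simp, by simp⟩
  | cons u us ih =>
    obtain ⟨V, _, _, E, b, hb, hcard, hE⟩ := ih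
    obtain ⟨W, _, _, p, F, hEF, hrig, hcard', hF⟩ := exists_attach_path u.toWord V E b b b hb
    refine ⟨W, inferInstance, inferInstance, F, p b, hrig, ?_, ?_⟩
    · rw [List.length_cons]; omega
    · intro α σ f hf v hv
      rcases List.mem_cons.1 hv with rfl | hv
      · simpa [FreeGroup.mk_toWord] using hF α σ f hf
      · exact hE α σ _ (hf.comp hEF) v hv

/-- Foldedness is what lets an injective map of vertices extend to a graph homomorphism for some
permutations. Rigidity descends to the folded quotient, and homomorphisms from the quotient pull
back to the rose. -/
lemma exists_folded_rose (us : List (FreeGrp r)) :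
    ∃ (V : Type) (_ : Fintype V) (_ : DecidableEq V) (E : Finset (V × Fin r × V)) (b : V),
      IsFoldedGraph E ∧ IsRigidAt E b ∧ E.card + 1 ≤ Fintype.card V + us.length ∧
      ∀ (α : Type) (σ : Fin r → Equiv.Perm α) (f : V → α), IsGraphHom E σ f →
        ∀ u ∈ us, FreeGroup.lift σ u (f b) = f b := by
  obtain ⟨V, _, _, E, b, hb, hcard, hE⟩ := exists_rose us
  obtain ⟨W, _, _, p, hp, hfold, hle⟩ := exists_folded _ V E rfl
  exact ⟨W, inferInstance, inferInstance, pushEdges p E, p b, hfold, hb.push hp, by omega,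
    fun α σ f hf => hE α σ _ (hf.comp subset_rfl)⟩

/-! ### Counting fixed points -/

/-- The domain and the range of a partial injection of a finite set have complements of equal size,
which can be matched arbitrarily. -/
lemma exists_perm_of_partial {α : Type} [Finite α] (R : α → α → Prop)
    (h1 : ∀ a b b', R a b → R a b' → b = b') (h2 : ∀ a a' b, R a b → R a' b → a = a') :
    ∃ σ : Equiv.Perm α, ∀ a b, R a b → σ a = b := by
  classical
  have := Fintype.ofFinite α
  choose g hg using fun a : {a // ∃ b, R a b} => a.2
  let f : {a // ∃ b, R a b} ≃ {b // ∃ a, R a b} :=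
    Equiv.ofBijective (fun a => ⟨g a, a, hg a⟩)
      ⟨fun a a' h => Subtype.ext (h2 _ _ _ (hg a) (by
          have : g a = g a' := congrArg Subtype.val h
          rw [this]; exact hg a')),
        fun ⟨b, a, hab⟩ => ⟨⟨a, b, hab⟩, Subtype.ext (h1 _ _ _ (hg ⟨a, b, hab⟩) hab)⟩⟩
  refine ⟨f.extendSubtype, fun a b hab => ?_⟩
  rw [Equiv.extendSubtype_apply_of_mem f a ⟨b, hab⟩]
  exact h1 _ _ _ (hg ⟨a, b, hab⟩) hab

/-- The proportion of the tuples of permutations for which an injective map of vertices is a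
graph homomorphism. -/
lemma card_perm_le_card_isGraphHom [DecidableEq V] {N : ℕ} {E : Finset (V × Fin r × V)} (hE : IsFoldedGraph E)
    (f : V → Fin N) (hf : f.Injective) :
    Nat.card (Fin r → Equiv.Perm (Fin N)) ≤
      N ^ E.card * Nat.card {σ : Fin r → Equiv.Perm (Fin N) // IsGraphHom E σ f} := by
  classical
  obtain ⟨σ₀, h₀⟩ : ∃ σ : Fin r → Equiv.Perm (Fin N), IsGraphHom E σ f := by
    choose σ hσ using fun x : Fin r => exists_perm_of_partial
      (fun a b : Fin N => ∃ s t, (s, x, t) ∈ E ∧ f s = a ∧ f t = b)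
      (by rintro _ _ _ ⟨s, t, h, rfl, rfl⟩ ⟨s', t', h', hs, rfl⟩
          rw [hE.1 _ _ _ _ h (hf hs ▸ h')])
      (by rintro _ _ _ ⟨s, t, h, rfl, rfl⟩ ⟨s', t', h', rfl, ht⟩
          rw [hE.2 _ _ _ _ h (hf ht ▸ h')])
    exact ⟨σ, fun s x t h => hσ x _ _ ⟨s, t, h, rfl, rfl⟩⟩
  -- Sort the tuples by where they send the sources of the edges. There are at most `N ^ E.card`
  -- classes, and each one injects into the set of compatible tuples.
  let ev : (Fin r → Equiv.Perm (Fin N)) → (E → Fin N) := fun σ e => σ e.1.2.1 (f e.1.1)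
  have hfib : ∀ y : E → Fin N, (Finset.univ.filter fun σ => ev σ = y).card ≤
      Nat.card {σ : Fin r → Equiv.Perm (Fin N) // IsGraphHom E σ f} := by
    intro y
    rw [Nat.card_eq_fintype_card, Fintype.card_subtype]
    by_cases hy : ∃ τ, ev τ = y
    · obtain ⟨τ, rfl⟩ := hy
      -- On the class of `τ`, left translation by `σ₀ * τ⁻¹` replaces the values of `τ` at the
      -- sources by those of `σ₀`, which are the required targets.
      refine Finset.card_le_card_of_injOn (fun σ => σ₀ * τ⁻¹ * σ) ?_
        (mul_right_injective _).injOn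
      intro σ hσ
      simp only [Finset.coe_filter, Finset.mem_univ, true_and, Set.mem_ofPred_eq] at hσ ⊢
      intro s x t h
      have h3 : σ x (f s) = τ x (f s) := congrFun hσ ⟨_, h⟩
      simp [h3, h₀ s x t h]
    · rw [Finset.card_eq_zero.2]
      · exact Nat.zero_le _
      · exact Finset.filter_eq_empty_iff.2 fun σ _ h => hy ⟨σ, h⟩
  rw [Nat.card_eq_fintype_card, ← Finset.card_univ]
  refine (Finset.card_le_mul_card_image_of_maps_to (t := Finset.univ) (f := ev)
    (fun _ _ => Finset.mem_univ _) _ fun y _ => hfib y).trans_eq ?_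
  simp [mul_comm]

/-- The number of pairs of a tuple of permutations and a point fixed by all of the words `us`. -/
noncomputable def fixCount (us : List (FreeGrp r)) (N : ℕ) : ℕ :=
  Nat.card {q : (Fin r → Equiv.Perm (Fin N)) × Fin N // ∀ u ∈ us, FreeGroup.lift q.1 u q.2 = q.2}

/-- Count pairs of an injective placement `f` and a compatible `σ`. By rigidity such a pair is
recovered from `σ` and the point `f b`, which all of `us` fix. -/
lemma descFactorial_mul_card_le [Fintype V] [DecidableEq V] {N : ℕ} {E : Finset (V × Fin r × V)} {b : V}
    (hE : IsFoldedGraph E) (hb : IsRigidAt E b) {us : List (FreeGrp r)}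
    (hus : ∀ (σ : Fin r → Equiv.Perm (Fin N)) (f : V → Fin N), IsGraphHom E σ f →
      ∀ u ∈ us, FreeGroup.lift σ u (f b) = f b) :
    N.descFactorial (Fintype.card V) * Nat.card (Fin r → Equiv.Perm (Fin N)) ≤
      N ^ E.card * fixCount us N := by
  classical
  have h1 : Nat.card (Σ f : V ↪ Fin N, {σ : Fin r → Equiv.Perm (Fin N) // IsGraphHom E σ f}) ≤
      fixCount us N := by
    refine Nat.card_le_card_of_injective
      (fun z => ⟨(z.2.1, z.1 b), hus _ _ z.2.2⟩) ?_
    rintro ⟨f, σ, hσ⟩ ⟨f', σ', hσ'⟩ h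
    simp only [Subtype.mk.injEq, Prod.mk.injEq] at h
    obtain ⟨rfl, hbb⟩ := h
    obtain rfl : f = f' := DFunLike.coe_injective (hb _ σ _ _ hσ hσ' hbb)
    rfl
  refine le_trans ?_ (Nat.mul_le_mul_left _ h1)
  rw [Nat.card_sigma, Finset.mul_sum]
  refine le_trans (le_of_eq ?_) (Finset.sum_le_sum fun f _ =>
    card_perm_le_card_isGraphHom hE f f.injective)
  simp [Fintype.card_embedding_eq]

end LabelledGraph

/-- Words `us` fix a given point with probability at least a constant multiple of
`N ^ (-length us)`. -/
lemma exists_fixCount_ge {r : ℕ} (us : List (FreeGrp r)) :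
    ∃ C : ℝ, 0 < C ∧ ∀ᶠ N : ℕ in atTop,
      C * (N : ℝ) ^ (1 - (us.length : ℤ)) * Nat.card (Fin r → Equiv.Perm (Fin N)) ≤
        fixCount us N := by
  obtain ⟨V, _, _, E, b, hfold, hrig, hcard, hus⟩ := exists_folded_rose us
  set v := Fintype.card V
  -- For `N ≥ 2 * v + 1`, each of the `v` factors of the descending factorial is at least `N / 2`.
  refine ⟨(1 / 2) ^ v, by positivity, ?_⟩
  filter_upwards [eventually_ge_atTop (2 * v + 1)] with N hN
  have hN0 : (0 : ℝ) < N := by exact_mod_cast (by omega : 0 < N)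
  have h1 := descFactorial_mul_card_le (N := N) hfold hrig fun σ f => hus _ σ f
  have h2 : ((N : ℝ) / 2) ^ v ≤ N.descFactorial v := by
    refine le_trans ?_ (Nat.cast_le.2 (Nat.pow_sub_le_descFactorial N v))
    push_cast [show v ≤ N + 1 by omega]
    refine pow_le_pow_left₀ (by positivity) ?_ _
    have : (2 * v + 1 : ℝ) ≤ N := by exact_mod_cast hN
    linarith
  have h3 : (N.descFactorial v : ℝ) * Nat.card (Fin r → Equiv.Perm (Fin N)) ≤
      (N : ℝ) ^ E.card * fixCount us N := by exact_mod_cast h1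
  -- This is where the Euler characteristic bound enters.
  have h4 : (N : ℝ) ^ (1 - (us.length : ℤ)) * N ^ E.card ≤ (N : ℝ) ^ v := by
    rw [← zpow_natCast, ← zpow_natCast, ← zpow_add₀ hN0.ne']
    exact zpow_le_zpow_right₀ (by exact_mod_cast hN0) (by omega)
  have hE0 : (0 : ℝ) < (N : ℝ) ^ E.card := by positivity
  refine le_of_mul_le_mul_left ?_ hE0
  refine le_trans ?_ h3
  refine le_trans ?_ (mul_le_mul_of_nonneg_right h2 (Nat.cast_nonneg _))
  rw [one_div, inv_pow, div_pow, ← mul_assoc]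
  refine mul_le_mul_of_nonneg_right ?_ (Nat.cast_nonneg _)
  rw [div_eq_mul_inv]
  calc (N : ℝ) ^ E.card * ((2 ^ v)⁻¹ * (N : ℝ) ^ (1 - (us.length : ℤ)))
      = ((N : ℝ) ^ (1 - (us.length : ℤ)) * N ^ E.card) * (2 ^ v)⁻¹ := by ring
    _ ≤ _ := mul_le_mul_of_nonneg_right h4 (by positivity)

/-! ### Word measures on generalized symmetric groups -/

lemma monomialMatrix_apply {N : ℕ} (σ : Equiv.Perm (Fin N)) (d : Fin N → Circle) (i j : Fin N) :
    (monomialMatrix σ d : Matrix (Fin N) (Fin N) ℂ) i j = if σ i = j then (d i : ℂ) else 0 :=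
  rfl

lemma monomialMatrix_inj {N : ℕ} {σ τ : Equiv.Perm (Fin N)} {d e : Fin N → Circle}
    (h : monomialMatrix σ d = monomialMatrix τ e) : σ = τ ∧ d = e := by
  have h1 : ∀ i j, (if σ i = j then (d i : ℂ) else 0) = if τ i = j then (e i : ℂ) else 0 :=
    fun i j => by rw [← monomialMatrix_apply, h, monomialMatrix_apply]
  have h2 : ∀ i, τ i = σ i := fun i => by
    have := h1 i (σ i)
    by_contra hne
    simp [hne] at this
  refine ⟨Equiv.ext fun i => (h2 i).symm, funext fun i => ?_⟩
  have := h1 i (σ i)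
  rw [h2 i] at this
  exact Circle.coe_injective (by simpa using this)

namespace WreathGL

variable {A : Subgroup Circle} {N r : ℕ}

/-- The permutation underlying a monomial matrix. -/
noncomputable def shape (g : wreathGL A N) : Equiv.Perm (Fin N) :=
  ((isMonomial_iff A (g : GL (Fin N) ℂ)).1 g.2).choose

/-- The non-zero entry in each row of a monomial matrix. -/
noncomputable def coef (g : wreathGL A N) : Fin N → Circle :=
  ((isMonomial_iff A (g : GL (Fin N) ℂ)).1 g.2).choose_spec.choose

lemma coef_mem (g : wreathGL A N) (i : Fin N) : coef g i ∈ A :=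
  ((isMonomial_iff A (g : GL (Fin N) ℂ)).1 g.2).choose_spec.choose_spec.1 i

lemma coe_eq (g : wreathGL A N) : (g : GL (Fin N) ℂ) = monomialMatrix (shape g) (coef g) :=
  ((isMonomial_iff A (g : GL (Fin N) ℂ)).1 g.2).choose_spec.choose_spec.2

lemma shape_coef_of_eq {g : wreathGL A N} {σ : Equiv.Perm (Fin N)} {d : Fin N → Circle}
    (h : (g : GL (Fin N) ℂ) = monomialMatrix σ d) : shape g = σ ∧ coef g = d :=
  monomialMatrix_inj ((coe_eq g).symm.trans h)

lemma shape_coef_mul (g h : wreathGL A N) : shape (g * h) = shape h * shape g ∧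
    coef (g * h) = fun i => coef g i * coef h (shape g i) :=
  shape_coef_of_eq (by rw [Subgroup.coe_mul, coe_eq g, coe_eq h, monomialMatrix_mul])

lemma shape_coef_one : shape (1 : wreathGL A N) = 1 ∧ coef (1 : wreathGL A N) = 1 :=
  shape_coef_of_eq (by rw [Subgroup.coe_one, monomialMatrix_one])

/-- The projection of `A ≀ S_N` to the symmetric group. -/
noncomputable def permHom : wreathGL A N →* Equiv.Perm (Fin N) where
  -- `shape` reverses products, so the inverse is needed for a homomorphism.
  toFun g := (shape g)⁻¹
  map_one' := by rw [shape_coef_one.1, inv_one]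
  map_mul' g h := by rw [(shape_coef_mul g h).1, mul_inv_rev]

/-- A cocycle identity: the coefficient at `i` is multiplicative when `g` fixes `i`. -/
lemma coef_mul (g h : wreathGL A N) (i : Fin N) :
    coef (g * h) i = coef g i * coef h ((permHom g)⁻¹ i) := by
  rw [(shape_coef_mul g h).2]
  simp [permHom]

lemma coef_one (i : Fin N) : coef (1 : wreathGL A N) i = 1 := by
  rw [shape_coef_one.2, Pi.one_apply]

lemma coef_inv (g : wreathGL A N) (i : Fin N) : coef g⁻¹ i = (coef g (permHom g i))⁻¹ := by
  have h := coef_mul g⁻¹ g i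
  rw [inv_mul_cancel, coef_one] at h
  rw [map_inv, inv_inv] at h
  exact eq_inv_of_mul_eq_one_left h.symm

lemma coe_apply (g : wreathGL A N) (i j : Fin N) :
    ((g : GL (Fin N) ℂ) : Matrix (Fin N) (Fin N) ℂ) i j =
      if permHom g j = i then (coef g i : ℂ) else 0 := by
  rw [coe_eq g, monomialMatrix_apply]
  refine if_congr ?_ rfl rfl
  simp only [permHom, MonoidHom.coe_mk, OneHom.coe_mk, Equiv.Perm.inv_eq_iff_eq]
  exact eq_comm

/-- The permutation matrices inside `A ≀ S_N`. -/
noncomputable def ofPerm (σ : Equiv.Perm (Fin N)) : wreathGL A N :=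
  ⟨monomialMatrix σ⁻¹ 1, (isMonomial_iff A _).2 ⟨_, _, fun _ => A.one_mem, rfl⟩⟩

lemma permHom_ofPerm (σ : Equiv.Perm (Fin N)) : permHom (ofPerm σ : wreathGL A N) = σ := by
  change (shape _)⁻¹ = σ
  rw [(shape_coef_of_eq (g := (ofPerm σ : wreathGL A N)) rfl).1, inv_inv]

lemma coef_ofPerm (σ : Equiv.Perm (Fin N)) (i : Fin N) :
    coef (ofPerm σ : wreathGL A N) i = 1 := by
  rw [(shape_coef_of_eq (g := (ofPerm σ : wreathGL A N)) rfl).2, Pi.one_apply]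

lemma permHom_lift {σ : Fin r → Equiv.Perm (Fin N)} {g : Fin r → wreathGL A N}
    (hg : ∀ x, permHom (g x) = σ x) (w : FreeGrp r) :
    permHom (FreeGroup.lift g w) = FreeGroup.lift σ w := by
  have : permHom.comp (FreeGroup.lift g) = FreeGroup.lift σ :=
    FreeGroup.ext_hom _ _ fun x => by simp [hg]
  exact DFunLike.congr_fun this w

lemma coef_lift_ofPerm (σ : Fin r → Equiv.Perm (Fin N)) (w : FreeGrp r) :
    ∀ i, coef (FreeGroup.lift (fun x => (ofPerm (σ x) : wreathGL A N)) w) i = 1 := by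
  induction w using FreeGroup.induction_on with
  | C1 => intro i; rw [map_one, coef_one]
  | of x => intro i; rw [FreeGroup.lift_apply_of, coef_ofPerm]
  | inv_of x ih => intro i; rw [map_inv, coef_inv, ih, inv_one]
  | mul u v hu hv => intro i; rw [map_mul, coef_mul, hu, hv, one_mul]

/-- Along a word, the ratio of the coefficients of two lifts of the same permutations depends only
on the ratios of the coefficients of the letters. -/
lemma coef_lift_mul_coef_lift {σ : Fin r → Equiv.Perm (Fin N)}
    {g₁ g₂ g₃ g₄ : Fin r → wreathGL A N}
    (h₁ : ∀ x, permHom (g₁ x) = σ x) (h₂ : ∀ x, permHom (g₂ x) = σ x)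
    (h₃ : ∀ x, permHom (g₃ x) = σ x) (h₄ : ∀ x, permHom (g₄ x) = σ x)
    (h : ∀ x i, coef (g₁ x) i * coef (g₄ x) i = coef (g₂ x) i * coef (g₃ x) i) (w : FreeGrp r) :
    ∀ i, coef (FreeGroup.lift g₁ w) i * coef (FreeGroup.lift g₄ w) i =
      coef (FreeGroup.lift g₂ w) i * coef (FreeGroup.lift g₃ w) i := by
  induction w using FreeGroup.induction_on with
  | C1 => intro i; simp only [map_one, coef_one]
  | of x => intro i; simpa only [FreeGroup.lift_apply_of] using h x i
  | inv_of x ih =>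
    intro i
    -- Inversion moves the evaluation point, hence the induction over all `i` at once.
    have := ih (FreeGroup.lift σ (FreeGroup.of x) i)
    simp only [map_inv, coef_inv, permHom_lift h₁, permHom_lift h₂, permHom_lift h₃,
      permHom_lift h₄]
    rw [← mul_inv, ← mul_inv]
    exact congrArg _ this
  | mul u v hu hv =>
    intro i
    simp only [map_mul, coef_mul, permHom_lift h₁, permHom_lift h₂, permHom_lift h₃,
      permHom_lift h₄]
    rw [mul_mul_mul_comm, hu, hv, mul_mul_mul_comm]

/-- If `w` is killed by all homomorphisms to `A` from a subgroup generated by words which fix `i`,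
then the corresponding diagonal entry is one. -/
lemma lift_apply_self_eq_one {σ : Fin r → Equiv.Perm (Fin N)} {g : Fin r → wreathGL A N}
    (hg : ∀ x, permHom (g x) = σ x) {us : List (FreeGrp r)} {i : Fin N}
    (hus : ∀ u ∈ us, FreeGroup.lift σ u i = i)
    (w : Subgroup.closure {u | u ∈ us}) (hw : ∀ φ : Subgroup.closure {u | u ∈ us} →* A, φ w = 1) :
    ((FreeGroup.lift g (w : FreeGrp r) : GL (Fin N) ℂ) : Matrix (Fin N) (Fin N) ℂ) i i = 1 := by
  have hfix : ∀ u ∈ Subgroup.closure {u | u ∈ us}, FreeGroup.lift σ u i = i := by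
    have : Subgroup.closure {u | u ∈ us} ≤
        (MulAction.stabilizer (Equiv.Perm (Fin N)) i).comap (FreeGroup.lift σ) :=
      (Subgroup.closure_le _).2 fun u hu => hus u hu
    exact fun u hu => this hu
  -- The subgroup fixes `i`, so there the cocycle becomes a homomorphism.
  let φ : Subgroup.closure {u | u ∈ us} →* A :=
    { toFun := fun u => ⟨coef (FreeGroup.lift g (u : FreeGrp r)) i, coef_mem _ _⟩
      map_one' := Subtype.ext (by simp [coef_one])
      map_mul' := fun u v => Subtype.ext (by
        simp only [Subgroup.coe_mul, map_mul, coef_mul, permHom_lift hg]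
        congr 2
        rw [Equiv.Perm.inv_eq_iff_eq, hfix u u.2]) }
  rw [coe_apply, permHom_lift hg, if_pos (hfix w w.2)]
  have : coef (FreeGroup.lift g (w : FreeGrp r)) i = 1 := congrArg Subtype.val (hw φ)
  rw [this, Circle.coe_one]

/-! ### Haar integration over the fibres above tuples of permutations -/

instance : SecondCountableTopology (Matrix (Fin N) (Fin N) ℂ) :=
  inferInstanceAs (SecondCountableTopology (Fin N → Fin N → ℂ))

instance : SecondCountableTopology (GL (Fin N) ℂ) := by
  have : SecondCountableTopology (Matrix (Fin N) (Fin N) ℂ)ᵐᵒᵖ :=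
    MulOpposite.opHomeomorph.symm.isEmbedding.secondCountableTopology
  have h : Topology.IsEmbedding (Units.embedProduct (Matrix (Fin N) (Fin N) ℂ)) :=
    Units.isEmbedding_embedProduct
  exact h.secondCountableTopology

/-- Makes the Borel and product σ-algebras on tuples agree, so that continuous functions of tuples
are measurable. -/
instance : SecondCountableTopology (wreathGL A N) :=
  TopologicalSpace.Subtype.secondCountableTopology _

variable (A) in
/-- The tuples of elements of `A ≀ S_N` lying over a given tuple of permutations. -/
def fiber (σ : Fin r → Equiv.Perm (Fin N)) : Set (Fin r → wreathGL A N) :=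
  {g | ∀ x, permHom (g x) = σ x}

lemma preimage_mul_fiber (m : Fin r → wreathGL A N) (σ : Fin r → Equiv.Perm (Fin N)) :
    (m * ·) ⁻¹' fiber A σ = fiber A (fun x => (permHom (m x))⁻¹ * σ x) := by
  ext g
  simp [fiber, eq_inv_mul_iff_mul_eq]

lemma continuous_entry (i j : Fin N) : Continuous fun g : wreathGL A N =>
    ((g : GL (Fin N) ℂ) : Matrix (Fin N) (Fin N) ℂ) i j :=
  (Units.continuous_val.comp continuous_subtype_val).matrix_elem i j

lemma isClosed_fiber (σ : Fin r → Equiv.Perm (Fin N)) : IsClosed (fiber A σ) := by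
  have : fiber A σ = ⋂ (x : Fin r) (i : Fin N) (j : Fin N) (_ : σ x j ≠ i),
      {g | ((g x : GL (Fin N) ℂ) : Matrix (Fin N) (Fin N) ℂ) i j = 0} := by
    ext g
    simp only [fiber, Set.mem_ofPred_eq, Set.mem_iInter, coe_apply]
    constructor
    · intro h x i j hij
      rw [if_neg (by rwa [h x])]
    · intro h x
      ext1 j
      by_contra hne
      have := h x (permHom (g x) j) j (Ne.symm hne)
      simp at this
  rw [this]
  exact isClosed_iInter fun x => isClosed_iInter fun i => isClosed_iInter fun j =>
    isClosed_iInter fun _ => isClosed_eq ((continuous_entry i j).comp (continuous_apply x))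
      continuous_const

lemma continuous_lift_apply {G : Type*} [Group G] [TopologicalSpace G] [IsTopologicalGroup G]
    (w : FreeGrp r) : Continuous fun g : Fin r → G => FreeGroup.lift g w := by
  induction w using FreeGroup.induction_on with
  | C1 => simpa using continuous_const
  | of x => simpa only [FreeGroup.lift_apply_of] using continuous_apply x
  | inv_of x ih => simp only [map_inv]; exact ih.inv
  | mul u v hu hv => simp only [map_mul]; exact hu.mul hv

instance {G : Type*} [Group G] [TopologicalSpace G] [IsTopologicalGroup G] [CompactSpace G]
    [MeasurableSpace G] [BorelSpace G] : IsProbabilityMeasure (haarProb G) :=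
  ⟨Measure.haarMeasure_self⟩

instance {G : Type*} [Group G] [TopologicalSpace G] [IsTopologicalGroup G] [CompactSpace G]
    [MeasurableSpace G] [BorelSpace G] : (haarProb G).IsMulLeftInvariant :=
  inferInstanceAs (Measure.haarMeasure ⊤).IsMulLeftInvariant

variable [CompactSpace (wreathGL A N)]

variable (A N r) in
/-- The product of the Haar probability measures. -/
noncomputable abbrev haarPi : Measure (Fin r → wreathGL A N) :=
  Measure.pi fun _ => haarProb (wreathGL A N)

lemma integral_eq_sum_fiber {F : (Fin r → wreathGL A N) → ℂ} (hF : Integrable F (haarPi A N r)) :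
    ∫ g, F g ∂haarPi A N r = ∑ σ, ∫ g in fiber A σ, F g ∂haarPi A N r := by
  rw [← integral_iUnion_fintype (fun σ => (isClosed_fiber σ).measurableSet) ?_
    fun σ => hF.integrableOn]
  · have : ⋃ σ, fiber A σ = (Set.univ : Set (Fin r → wreathGL A N)) :=
      Set.eq_univ_of_forall fun g => Set.mem_iUnion.2 ⟨fun x => permHom (g x), fun _ => rfl⟩
    rw [this, Measure.restrict_univ]
  · intro σ τ hne
    refine Set.disjoint_left.2 fun g hg hg' => hne (funext fun x => ?_)
    rw [← hg x, hg' x]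

/-- Left translation by permutation matrices carries any fibre to any other, and the fibres
partition a space of total mass one. -/
lemma measureReal_fiber (σ : Fin r → Equiv.Perm (Fin N)) :
    (haarPi A N r).real (fiber A σ) = (Nat.card (Fin r → Equiv.Perm (Fin N)) : ℝ)⁻¹ := by
  have heq : ∀ τ, (haarPi A N r).real (fiber A τ) = (haarPi A N r).real (fiber A σ) := by
    intro τ
    have := preimage_mul_fiber (A := A) (fun x => ofPerm (σ x * (τ x)⁻¹)) σ
    simp only [permHom_ofPerm, mul_inv_rev, inv_inv, inv_mul_cancel_right] at this
    rw [← this, measureReal_def, measure_preimage_mul, measureReal_def]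
  have h := integral_eq_sum_fiber (A := A) (N := N) (r := r) (integrable_const (1 : ℂ))
  simp only [integral_const, measureReal_restrict_apply_univ, heq, probReal_univ] at h
  simp only [one_smul, Finset.sum_const, Finset.card_univ, nsmul_eq_mul] at h
  rw [Nat.card_eq_fintype_card]
  refine eq_inv_of_mul_eq_one_right ?_
  simp only [Complex.real_smul, mul_one] at h
  exact_mod_cast h.symm

/-- The diagonal entries of `w` either are identically one on a fiber, or integrate to zero. -/
lemma fiber_integral_dichotomy (w : FreeGrp r) (σ : Fin r → Equiv.Perm (Fin N)) (i : Fin N) :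
    (∀ g ∈ fiber A σ,
      ((FreeGroup.lift g w : GL (Fin N) ℂ) : Matrix (Fin N) (Fin N) ℂ) i i = 1) ∨
    ∫ g in fiber A σ, ((FreeGroup.lift g w : GL (Fin N) ℂ) : Matrix (Fin N) (Fin N) ℂ) i i
      ∂haarPi A N r = 0 := by
  have hmeas := (isClosed_fiber (A := A) σ).measurableSet
  by_cases hfix : FreeGroup.lift σ w i = i
  swap
  · right
    refine setIntegral_eq_zero_of_forall_eq_zero fun g hg => ?_
    rw [coe_apply, permHom_lift hg, if_neg hfix]
  have hval : ∀ g ∈ fiber A σ,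
      ((FreeGroup.lift g w : GL (Fin N) ℂ) : Matrix (Fin N) (Fin N) ℂ) i i =
        (coef (FreeGroup.lift g w) i : ℂ) := fun g hg => by
    rw [coe_apply, permHom_lift hg, if_pos hfix]
  by_cases hone : ∀ g ∈ fiber A σ, coef (FreeGroup.lift g w) i = 1
  · exact Or.inl fun g hg => by rw [hval g hg, hone g hg, Circle.coe_one]
  push Not at hone
  obtain ⟨g₀, hg₀, hne⟩ := hone
  right
  let p : Fin r → wreathGL A N := fun x => ofPerm (σ x)
  have hp : p ∈ fiber A σ := fun x => permHom_ofPerm _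
  -- The quotient of a tuple with coefficient different from one by the permutation matrices lies
  -- over the identity. Translation by it preserves the fibre and multiplies the coefficient of `w`
  -- at `i` by a constant different from one.
  let d : Fin r → wreathGL A N := g₀ * p⁻¹
  have hd : ∀ x, permHom (d x) = 1 := fun x => by
    simp only [d, Pi.mul_apply, Pi.inv_apply, map_mul, map_inv, hg₀ x, hp x, mul_inv_cancel]
  have hdp : ∀ x, d x * p x = g₀ x := fun x => by simp [d]
  have hpre : (d * ·) ⁻¹' fiber A σ = fiber A σ := by
    rw [preimage_mul_fiber]
    simp [hd]
  have htrans : ∀ g ∈ fiber A σ, coef (FreeGroup.lift (d * g) w) i =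
      coef (FreeGroup.lift g w) i * coef (FreeGroup.lift g₀ w) i := by
    intro g hg
    have hdg : d * g ∈ fiber A σ := by rwa [← hpre] at hg
    have := coef_lift_mul_coef_lift hdg hg hg₀ hp (fun x j => by
      rw [← hdp x, Pi.mul_apply, coef_mul, coef_mul, hd x, coef_ofPerm]
      simp only [inv_one, Equiv.Perm.one_apply, p, coef_ofPerm, mul_one]
      exact mul_comm _ _) w i
    rwa [coef_lift_ofPerm, mul_one] at this
  set h : (Fin r → wreathGL A N) → ℂ :=
    fun g => ((FreeGroup.lift g w : GL (Fin N) ℂ) : Matrix (Fin N) (Fin N) ℂ) i i with hh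
  -- Invariance makes the integral equal to itself times that constant, so it vanishes.
  have h1 : ∫ g in fiber A σ, h g ∂haarPi A N r =
      (∫ g in fiber A σ, h g ∂haarPi A N r) * (coef (FreeGroup.lift g₀ w) i : ℂ) := by
    rw [← integral_mul_const, ← integral_indicator hmeas, ← integral_indicator hmeas,
      ← integral_mul_left_eq_self ((fiber A σ).indicator h) d]
    congr 1
    funext g
    by_cases hg : g ∈ fiber A σ
    · have hdg : d * g ∈ fiber A σ := by rwa [← hpre] at hg
      rw [Set.indicator_of_mem hg, Set.indicator_of_mem hdg]
      simp only [hh]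
      rw [hval g hg, hval _ hdg, htrans g hg, Circle.coe_mul]
    · have hdg : d * g ∉ fiber A σ := by rwa [← hpre] at hg
      rw [Set.indicator_of_notMem hg, Set.indicator_of_notMem hdg]
  have h2 : (1 : ℂ) - (coef (FreeGroup.lift g₀ w) i : ℂ) ≠ 0 := by
    rw [sub_ne_zero]
    exact fun h => hne (Circle.coe_injective (h.symm.trans Circle.coe_one.symm))
  refine (mul_eq_zero.1 ?_).resolve_right h2
  rw [mul_sub, ← h1, mul_one, sub_self]

/-- A lower bound for the expected trace. -/
lemma fixCount_div_le_norm_expTrace (us : List (FreeGrp r))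
    (w : Subgroup.closure {u | u ∈ us}) (hw : ∀ φ : Subgroup.closure {u | u ∈ us} →* A, φ w = 1) :
    (fixCount us N : ℝ) / Nat.card (Fin r → Equiv.Perm (Fin N)) ≤
      ‖expTrace (wreathGL A N) (w : FreeGrp r)‖ := by
  classical
  set h : Fin N → (Fin r → wreathGL A N) → ℂ := fun i g =>
    ((FreeGroup.lift g (w : FreeGrp r) : GL (Fin N) ℂ) : Matrix (Fin N) (Fin N) ℂ) i i with hh
  have hcont : ∀ i, Continuous (h i) := fun i =>
    (continuous_entry i i).comp (continuous_lift_apply _)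
  have hint : ∀ i, Integrable (h i) (haarPi A N r) := fun i =>
    (hcont i).integrable_of_hasCompactSupport (HasCompactSupport.of_compactSpace _)
  have htr : expTrace (wreathGL A N) (w : FreeGrp r) =
      ∑ i, ∑ σ, ∫ g in fiber A σ, h i g ∂haarPi A N r := by
    rw [expTrace, wordMeasure, integral_map (continuous_lift_apply _).measurable.aemeasurable]
    · simp only [Matrix.trace, Matrix.diag_apply]
      rw [integral_finsetSum _ fun i _ => hint i]
      exact Finset.sum_congr rfl fun i _ => integral_eq_sum_fiber (hint i)
    · refine Continuous.aestronglyMeasurable ?_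
      exact continuous_finsetSum _ fun i _ => continuous_entry i i
  -- By the dichotomy, pairs not fixed by all of `us` contribute a nonnegative real part and may be
  -- discarded.
  have hle : ∀ (i : Fin N) (σ : Fin r → Equiv.Perm (Fin N)), (if ∀ u ∈ us, FreeGroup.lift σ u i = i then
      (Nat.card (Fin r → Equiv.Perm (Fin N)) : ℝ)⁻¹ else 0) ≤
      (∫ g in fiber A σ, h i g ∂haarPi A N r).re := by
    intro i σ
    have hone : (∀ g ∈ fiber A σ, h i g = 1) →
        (∫ g in fiber A σ, h i g ∂haarPi A N r).re =
          (Nat.card (Fin r → Equiv.Perm (Fin N)) : ℝ)⁻¹ := by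
      intro h1
      rw [setIntegral_congr_fun (isClosed_fiber σ).measurableSet h1, setIntegral_const,
        measureReal_fiber, Complex.real_smul, mul_one, Complex.ofReal_re]
    split_ifs with hfix
    · exact (hone fun g hg => lift_apply_self_eq_one hg hfix w hw).ge
    · rcases fiber_integral_dichotomy (A := A) (w : FreeGrp r) σ i with h1 | h1
      · rw [hone h1]; positivity
      · simp only [hh]; rw [h1, Complex.zero_re]
  refine le_trans ?_ (Complex.re_le_norm _)
  rw [htr, Complex.re_sum]
  simp only [Complex.re_sum]
  refine le_trans (le_of_eq ?_) (Finset.sum_le_sum fun i _ => Finset.sum_le_sum fun σ _ => hle i σ)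
  rw [Finset.sum_comm, ← Finset.sum_product', Finset.univ_product_univ, ← Finset.sum_filter,
    Finset.sum_const, nsmul_eq_mul, div_eq_mul_inv, fixCount, Nat.card_eq_fintype_card,
    Fintype.card_subtype]

end WreathGL

/-! ### Ranks of subgroups and the invariants `χ_m` -/

lemma oneSub_antitone : Antitone oneSub := by
  intro a b h
  induction b using ENat.recTopCoe with
  | top => exact bot_le
  | coe b =>
    induction a using ENat.recTopCoe with
    | top => exact absurd (top_le_iff.1 h) (ENat.natCast_ne_top b)
    | coe a =>
      have : a ≤ b := by exact_mod_cast h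
      exact WithBot.coe_le_coe.2 (by omega)

lemma expHom_surjective (m : ℕ) (G : Type*) [Group G] [IsFreeGroup G] :
    Function.Surjective (expHom m G) := by
  intro y
  obtain ⟨y, rfl⟩ := Multiplicative.ofAdd.surjective y
  induction y using Finsupp.induction_linear with
  | zero => exact ⟨1, map_one _⟩
  | add y z hy hz =>
    obtain ⟨a, ha⟩ := hy
    obtain ⟨b, hb⟩ := hz
    exact ⟨a * b, by rw [map_mul, ha, hb, ofAdd_add]⟩
  | single x c =>
    obtain ⟨n, rfl⟩ := ZMod.intCast_surjective c
    refine ⟨IsFreeGroup.of x ^ n, ?_⟩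
    rw [map_zpow, expHom, IsFreeGroup.lift_of, ← ofAdd_zsmul, Finsupp.smul_single, zsmul_one]

/-- The rank of a free group is at most the number of elements of any generating set. -/
lemma freeRank_le_card (G : Type*) [Group G] [IsFreeGroup G] (S : Finset G)
    (hS : Subgroup.closure (S : Set G) = ⊤) : freeRank G ≤ S.card := by
  classical
  -- Modulo 2 the generating set becomes a spanning set of a vector space whose dimension is the
  -- rank.
  let T : Finset (IsFreeGroup.Generators G →₀ ZMod 2) :=
    S.image fun g => Multiplicative.toAdd (expHom 2 G g)
  have hT : Submodule.span (ZMod 2) (T : Set (IsFreeGroup.Generators G →₀ ZMod 2)) = ⊤ := by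
    rw [eq_top_iff]
    rintro y -
    obtain ⟨g, hg⟩ := expHom_surjective 2 G (Multiplicative.ofAdd y)
    have hle : Subgroup.closure (S : Set G) ≤
        (AddSubgroup.toSubgroup (Submodule.span (ZMod 2)
          (T : Set (IsFreeGroup.Generators G →₀ ZMod 2))).toAddSubgroup).comap (expHom 2 G) := by
      rw [Subgroup.closure_le]
      intro a ha
      exact Submodule.subset_span (Finset.mem_coe.2 (Finset.mem_image_of_mem _ ha))
    have := hle (hS ▸ Subgroup.mem_top g)
    rw [Subgroup.mem_comap, hg] at this
    exact this
  have h1 := linearIndependent_le_span _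
    (Finsupp.basisSingleOne (R := ZMod 2) (ι := IsFreeGroup.Generators G)).linearIndependent _ hT
  have h2 : Fintype.card (T : Set (IsFreeGroup.Generators G →₀ ZMod 2)) ≤ S.card := by
    simpa using (Finset.card_image_le : T.card ≤ S.card)
  have h3 := Cardinal.toENat.monotone' (h1.trans (Nat.cast_le.2 h2))
  simpa [freeRank, ENat.card] using h3

lemma freeRank_closure_le {r : ℕ} (us : List (FreeGrp r)) :
    freeRank (Subgroup.closure {u | u ∈ us}) ≤ us.length := by
  classical
  let S : Finset (Subgroup.closure {u | u ∈ us}) :=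
    (us.attach.map fun u => ⟨u.1, Subgroup.subset_closure u.2⟩).toFinset
  have hS : (S : Set (Subgroup.closure {u | u ∈ us})) = Subtype.val ⁻¹' {u | u ∈ us} := by
    ext u
    simp only [S, List.coe_toFinset, List.mem_map, List.mem_attach, true_and, Subtype.exists,
      Set.mem_ofPred_eq, Set.mem_preimage]
    exact ⟨fun ⟨a, ha, h⟩ => h ▸ ha, fun h => ⟨u, h, rfl⟩⟩
  refine (freeRank_le_card _ S ?_).trans (Nat.cast_le.2 ?_)
  · rw [hS, Subgroup.closure_closure_coe_preimage]
  · exact (List.toFinset_card_le _).trans (by simp)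

lemma oneSub_length_le_chi {r : ℕ} {m : ℕ∞} {us : List (FreeGrp r)}
    (w : Subgroup.closure {u | u ∈ us}) (hw : w ∈ freeK m (Subgroup.closure {u | u ∈ us})) :
    oneSub us.length ≤ chi m (w : FreeGrp r) := by
  refine oneSub_antitone (le_trans (sInf_le ?_) (freeRank_closure_le us))
  exact ⟨_, ⟨w, hw, rfl⟩, rfl⟩

/-- Elements killed by every homomorphism to a commutative group lie in `K_∞`. -/
lemma mem_freeK_top {G : Type} [Group G] [IsFreeGroup G] {w : G}
    (hw : ∀ (B : Type) [CommGroup B] (φ : G →* B), φ w = 1) : w ∈ freeK ⊤ G := by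
  change w ∈ commutator G
  rw [← Abelianization.ker_of]
  exact hw _ _

/-- Elements killed by every homomorphism to a commutative group of exponent two lie in `K_2`. -/
lemma mem_freeK_two {G : Type} [Group G] [IsFreeGroup G] {w : G}
    (hw : ∀ (B : Type) [CommGroup B] (φ : G →* B), (∀ b : B, b ^ 2 = 1) → φ w = 1) :
    w ∈ freeK 2 G := by
  change w ∈ (expHom 2 G).ker
  refine hw _ _ fun b => ?_
  obtain ⟨y, rfl⟩ := Multiplicative.ofAdd.surjective b
  rw [← ofAdd_nsmul, ← ofAdd_zero]
  congr 1
  ext x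
  rw [Finsupp.smul_apply, nsmul_eq_mul, Nat.cast_ofNat, Finsupp.zero_apply]
  exact mul_eq_zero_of_left (by decide) _

/-- The group `A` matters only through which words its characters kill; the count of fixed points
does not involve it. -/
lemma isBigOmega_expTrace {r : ℕ} (A : Subgroup Circle) [∀ N, CompactSpace (wreathGL A N)]
    {us : List (FreeGrp r)} (w : Subgroup.closure {u | u ∈ us})
    (hw : ∀ φ : Subgroup.closure {u | u ∈ us} →* A, φ w = 1) :
    IsBigOmega (fun N => expTrace (wreathGL A N) (w : FreeGrp r))
      (fun N => powExt N (oneSub us.length)) := by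
  obtain ⟨C, hC, h⟩ := exists_fixCount_ge us
  refine ⟨C, hC, h.mono fun N hN => ?_⟩
  refine le_trans ?_ (WreathGL.fixCount_div_le_norm_expTrace us w hw)
  rw [le_div_iff₀ (Nat.cast_pos.2 Nat.card_pos)]
  exact hN

lemma isBigOmega_powExt_bot (f : ℕ → ℂ) : IsBigOmega f (fun N => powExt N ⊥) :=
  ⟨1, one_pos, Eventually.of_forall fun n => by simp [powExt]⟩

/-! ### Products of commutators and of squares -/

/-- A finite infimum is attained, and the entries of an optimal product of commutators serve as
generators. Allowing every commutative target covers both the abelianization, used for `chi`, and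
`A`, used for the trace. -/
lemma exists_commLength_generators {r g : ℕ} {w : FreeGrp r} (h : commLength w = g) :
    ∃ us : List (FreeGrp r), us.length = 2 * g ∧ ∃ w' : Subgroup.closure {u | u ∈ us},
      (w' : FreeGrp r) = w ∧
        ∀ (B : Type) [CommGroup B] (φ : Subgroup.closure {u | u ∈ us} →* B), φ w' = 1 := by
  have hne : {n : ℕ∞ | ∃ g : ℕ, n = g ∧ ∃ u v : Fin g → FreeGrp r,
      w = (List.ofFn fun i => u i * v i * (u i)⁻¹ * (v i)⁻¹).prod}.Nonempty := by
    by_contra hne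
    rw [commLength, Set.not_nonempty_iff_eq_empty.1 hne, sInf_empty] at h
    exact ENat.natCast_ne_top g h.symm
  obtain ⟨g', hg', u, v, hw⟩ := csInf_mem hne
  obtain rfl : g = g' := by
    change commLength w = g' at hg'
    exact_mod_cast h.symm.trans hg'
  have hu : ∀ i, u i ∈ Subgroup.closure {x | x ∈ List.ofFn u ++ List.ofFn v} := fun i =>
    Subgroup.subset_closure (List.mem_append_left _ (List.mem_ofFn.2 ⟨i, rfl⟩))
  have hv : ∀ i, v i ∈ Subgroup.closure {x | x ∈ List.ofFn u ++ List.ofFn v} := fun i =>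
    Subgroup.subset_closure (List.mem_append_right _ (List.mem_ofFn.2 ⟨i, rfl⟩))
  refine ⟨List.ofFn u ++ List.ofFn v, by simp [two_mul],
    (List.ofFn fun i => ⟨u i, hu i⟩ * ⟨v i, hv i⟩ * ⟨u i, hu i⟩⁻¹ * ⟨v i, hv i⟩⁻¹).prod, ?_, ?_⟩
  · rw [← Subgroup.subtype_apply, map_list_prod, List.map_ofFn, hw]
    rfl
  · intro B _ φ
    rw [map_list_prod, List.map_ofFn]
    refine List.prod_eq_one fun b hb => ?_
    obtain ⟨i, rfl⟩ := List.mem_ofFn.1 hb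
    simp only [Function.comp_apply, map_mul, map_inv, mul_inv_cancel_comm, mul_inv_cancel]

lemma exists_squareLength_generators {r g : ℕ} {w : FreeGrp r} (h : squareLength w = g) :
    ∃ us : List (FreeGrp r), us.length = g ∧ ∃ w' : Subgroup.closure {u | u ∈ us},
      (w' : FreeGrp r) = w ∧
        ∀ (B : Type) [CommGroup B] (φ : Subgroup.closure {u | u ∈ us} →* B),
          (∀ b : B, b ^ 2 = 1) → φ w' = 1 := by
  have hne : {n : ℕ∞ | ∃ g : ℕ, n = g ∧ ∃ u : Fin g → FreeGrp r,
      w = (List.ofFn fun i => u i ^ 2).prod}.Nonempty := by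
    by_contra hne
    rw [squareLength, Set.not_nonempty_iff_eq_empty.1 hne, sInf_empty] at h
    exact ENat.natCast_ne_top g h.symm
  obtain ⟨g', hg', u, hw⟩ := csInf_mem hne
  obtain rfl : g = g' := by
    change squareLength w = g' at hg'
    exact_mod_cast h.symm.trans hg'
  have hu : ∀ i, u i ∈ Subgroup.closure {x | x ∈ List.ofFn u} := fun i =>
    Subgroup.subset_closure (List.mem_ofFn.2 ⟨i, rfl⟩)
  refine ⟨List.ofFn u, by simp, (List.ofFn fun i => ⟨u i, hu i⟩ ^ 2).prod, ?_, ?_⟩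
  · rw [← Subgroup.subtype_apply, map_list_prod, List.map_ofFn, hw]
    rfl
  · intro B _ φ hB
    rw [map_list_prod, List.map_ofFn]
    refine List.prod_eq_one fun b hb => ?_
    obtain ⟨i, rfl⟩ := List.mem_ofFn.1 hb
    rw [Function.comp_apply, map_pow, hB]

lemma exists_min_generators {r g : ℕ} {w : FreeGrp r}
    (h : min (squareLength w) (2 * commLength w) = g) :
    ∃ us : List (FreeGrp r), us.length = g ∧ ∃ w' : Subgroup.closure {u | u ∈ us},
      (w' : FreeGrp r) = w ∧
        ∀ (B : Type) [CommGroup B] (φ : Subgroup.closure {u | u ∈ us} →* B),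
          (∀ b : B, b ^ 2 = 1) → φ w' = 1 := by
  rcases min_choice (squareLength w) (2 * commLength w) with h' | h'
  · exact exists_squareLength_generators (h'.symm.trans h)
  -- Commutators die in every commutative group, so the exponent two condition is not needed here.
  · have h2 : 2 * commLength w = g := h'.symm.trans h
    obtain ⟨c, hc⟩ : ∃ c : ℕ, commLength w = c := by
      refine ENat.ne_top_iff_exists.1 (fun htop => ?_) |>.imp fun _ => Eq.symm
      rw [htop, ENat.mul_top two_ne_zero] at h2
      exact ENat.natCast_ne_top g h2.symm
    obtain ⟨us, hlen, w', hw', hφ⟩ := exists_commLength_generators hc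
    refine ⟨us, ?_, w', hw', fun B _ φ _ => hφ B φ⟩
    rw [hc] at h2
    rw [hlen]
    exact_mod_cast h2

theorem corollary3p7 (r : ℕ) (w : FreeGrp r) :
    oneSub (2 * commLength w) ≤ chi ⊤ w ∧
    oneSub (min (squareLength w) (2 * commLength w)) ≤ chi 2 w ∧
    IsBigOmega (fun N => expTrace (circleWreath N) w)
      (fun N => powExt N (oneSub (2 * commLength w))) ∧
    IsBigOmega (fun N => expTrace (cyclicWreath 2 N) w)
      (fun N => powExt N (oneSub (min (squareLength w) (2 * commLength w)))) := by
  have h1 : oneSub (2 * commLength w) ≤ chi ⊤ w ∧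
      IsBigOmega (fun N => expTrace (circleWreath N) w)
        (fun N => powExt N (oneSub (2 * commLength w))) := by
    cases hg : commLength w using ENat.recTopCoe with
    | top =>
      rw [ENat.mul_top two_ne_zero]
      exact ⟨bot_le, isBigOmega_powExt_bot _⟩
    | coe g =>
      obtain ⟨us, hlen, w', rfl, hφ⟩ := exists_commLength_generators hg
      have h2 : 2 * (g : ℕ∞) = us.length := by rw [hlen]; push_cast; rfl
      rw [h2]
      exact ⟨oneSub_length_le_chi w' (mem_freeK_top hφ), isBigOmega_expTrace ⊤ w' (hφ _)⟩
  have h2 : oneSub (min (squareLength w) (2 * commLength w)) ≤ chi 2 w ∧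
      IsBigOmega (fun N => expTrace (cyclicWreath 2 N) w)
        (fun N => powExt N (oneSub (min (squareLength w) (2 * commLength w)))) := by
    cases hg : min (squareLength w) (2 * commLength w) using ENat.recTopCoe with
    | top => exact ⟨bot_le, isBigOmega_powExt_bot _⟩
    | coe g =>
      obtain ⟨us, rfl, w', rfl, hφ⟩ := exists_min_generators hg
      exact ⟨oneSub_length_le_chi w' (mem_freeK_two hφ),
        -- Membership in the kernel of squaring is exactly the exponent two condition.
        isBigOmega_expTrace _ w' fun φ => hφ _ φ fun b => Subtype.ext b.2⟩
  exact ⟨h1.1, h2.1, h1.2, h2.2⟩
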